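/- Let $-\infty<a<b<\infty$, $0<\alpha<1$, $0\le\beta\le1$ and $\gamma=\alpha+\beta-\alpha\beta$. **Notation.** For $\sigma>0$ and $x>a$ let $I_{a^+}^{\sigma}y(x)=\frac1{\Gamma(\sigma)}\int_a^x\frac{y(t)\,dt}{(x-t)^{1-\sigma}}$ be the Riemann–Liouville fractional integral, and let $I_{a^+}^{0}y=y$. For $y\in L^1(a,b)$ the Hilfer derivative of order $\alpha$ and type $\beta$ is $$D_{a^+}^{\alpha,\beta}y=I_{a^+}^{\beta(1-\alpha)}\,\frac{d}{dx}\,I_{a^+}^{(1-\beta)(1-\alpha)}y .$$ It is said to exist on $(a,b]$ if $w=I_{a^+}^{(1-\beta)(1-\alpha)}y$ is absolutely continuous on every $[c,b]$, $a<c<b$, and for every $x\in(a,b]$ the Lebesgue integral defining $I_{a^+}^{\beta(1-\alpha)}w'(x)$ converges (if $\beta=0$: $w'(x)$ exists for every $x\in(a,b]$, one-sided at $b$). For $0\le\mu<1$, $C_{\mu}[a,b]$ is the set of functions $y:(a,b]\to\mathbb R$ such that $(x-a)^{\mu}y(x)$ extends to a continuous function on $[a,b]$, and $C_{1-\gamma}^{\alpha,\beta}[a,b]$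 is the set of $y\in C_{1-\gamma}[a,b]$ for which $D_{a^+}^{\alpha,\beta}y$ exists on $(a,b]$ and belongs to $C_{1-\gamma}[a,b]$. **Theorem 4.2.** Let $f:(a,b]\times\mathbb R\to\mathbb R$ be such that $x\mapsto f(x,y(x))$ belongs to $C_{1-\gamma}[a,b]$ for every $y\in C_{1-\gamma}[a,b]$, and suppose that for some $A>0$ $$|f(x,y_1)-f(x,y_2)|\le A|y_1-y_2|\qquad\text{for all }x\in(a,b],\ y_1,y_2\in\mathbb R .$$ Let $y_a,\epsilon\in\mathbb R$, and let $y,\hat y\in C_{1-\gamma}^{\alpha,\beta}[a,b]$ satisfy $$D_{a^+}^{\alpha,\beta}y(x)=f(x,y(x))\ \ (a<x\le b),\qquad \lim_{x\to a^+}I_{a^+}^{1-\gamma}y(x)=y_a,$$ $$D_{a^+}^{\alpha,\beta}\hat y(x)=f(x,\hat y(x))\ \ (a<x\le b),\qquad \lim_{x\to a^+}I_{a^+}^{1-\gamma}\hat y(x)=y_a+\epsilon .$$ Then $$|y(x)-\hat y(x)|\le|\epsilon|\,(x-a)^{\gamma-1}E_{\alpha,\gamma}\big(A(x-a)^{\alpha}\big)\qquad\text{for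 all }x\in(a,b],$$ where $E_{\alpha,\gamma}(z)=\sum_{k=0}^{\infty}\frac{z^k}{\Gamma(k\alpha+\gamma)}$ is the two-parameter Mittag-Leffler function. -/

import Mathlib

open Set MeasureTheory Filter Topology

noncomputable section

/-- The weighted space `C_μ[a,b]`: functions `y` on `(a,b]` such that `(x - a)^μ * y x` is (the
restriction to `(a,b]` of) a continuous function on `[a,b]`. Functions on `(a,b]` are represented
by functions on `ℝ` of which only the values on `(a,b]` matter. -/
def MemWeightedC (a b μ : ℝ) (y : ℝ → ℝ) : Prop :=
  ∃ g : ℝ → ℝ, ContinuousOn g (Icc a b) ∧ ∀ x ∈ Ioc a b, g x = (x - a) ^ μ * y x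

/-- The Riemann–Liouville fractional integral `I_{a+}^σ y (x)` for `σ ≥ 0`, `x > a`, with the
usual convention that `I_{a+}^0` is the identity. -/
def fracIntegral (a σ : ℝ) (y : ℝ → ℝ) (x : ℝ) : ℝ :=
  if σ = 0 then y x
  else 1 / Real.Gamma σ * ∫ t in a..x, y t / (x - t) ^ (1 - σ)

/-- The derivative `D I_{a+}^{(1-β)(1-α)} y` on `(a,b]` (one-sided at `b`). -/
def innerDeriv (a b α β : ℝ) (y : ℝ → ℝ) (x : ℝ) : ℝ :=
  derivWithin (fracIntegral a ((1 - β) * (1 - α)) y) (Ioc a b) x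

/-- The Hilfer derivative of order `0 < α < 1` and type `0 ≤ β ≤ 1` on `(a,b]`,
`D_{a+}^{α,β} y = I_{a+}^{β(1-α)} D I_{a+}^{(1-β)(1-α)} y`. It is meaningful for functions that
satisfy `HilferDifferentiable`. -/
def hilferDeriv (a b α β : ℝ) (y : ℝ → ℝ) (x : ℝ) : ℝ :=
  fracIntegral a (β * (1 - α)) (innerDeriv a b α β y) x

/-- The Hilfer derivative of `y ∈ L¹(a,b)` exists at every point of `(a,b]`: the inner fractional
integral `w = I_{a+}^{(1-β)(1-α)} y` is locally absolutely continuous on `(a,b]`, and the outer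
fractional integral of `w'` exists (as a Lebesgue integral) at each `x ∈ (a,b]`; if the outer
operator is the identity, the latter means that `w' x` itself exists. -/
structure HilferDifferentiable (a b α β : ℝ) (y : ℝ → ℝ) : Prop where
  integrable : IntegrableOn y (Ioc a b)
  absCont : ∀ c ∈ Ioo a b,
    AbsolutelyContinuousOnInterval (fracIntegral a ((1 - β) * (1 - α)) y) c b
  outer_of_eq_zero : β * (1 - α) = 0 → ∀ x ∈ Ioc a b,
    DifferentiableWithinAt ℝ (fracIntegral a ((1 - β) * (1 - α)) y) (Ioc a b) x
  outer_of_ne_zero : β * (1 - α) ≠ 0 → ∀ x ∈ Ioc a b,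
    IntervalIntegrable (fun t => innerDeriv a b α β y t / (x - t) ^ (1 - β * (1 - α))) volume a x

/-- The space `C_{1-γ}^{α,β}[a,b]`, `γ = α + β(1-α)`: functions in `C_{1-γ}[a,b]` whose Hilfer
derivative exists and lies in `C_{1-γ}[a,b]`. -/
def MemHilferSpace (a b α β : ℝ) (y : ℝ → ℝ) : Prop :=
  MemWeightedC a b (1 - (α + β * (1 - α))) y ∧
  HilferDifferentiable a b α β y ∧
  MemWeightedC a b (1 - (α + β * (1 - α))) (hilferDeriv a b α β y)

/-- `y ∈ C_{1-γ}^{α,β}[a,b]` solves the Cauchy-type problem `D_{a+}^{α,β} y (x) = f (x, y x)` on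
`(a,b]`, `I_{a+}^{1-γ} y (a) = ya`, where `γ = α + β(1-α)` and the value at `a` is the limit
from the right. -/
structure IsCauchySolution (a b α β : ℝ) (f : ℝ → ℝ → ℝ) (ya : ℝ) (y : ℝ → ℝ) : Prop where
  mem : MemHilferSpace a b α β y
  equation : ∀ x ∈ Ioc a b, hilferDeriv a b α β y x = f x (y x)
  initial : Tendsto (fracIntegral a (1 - (α + β * (1 - α))) y) (𝓝[>] a) (𝓝 ya)

/-- The two-parameter Mittag-Leffler function
`E_{α,γ}(z) = ∑_{k ≥ 0} z^k / Γ(k α + γ)` (used for `α, γ > 0`, where the series converges). -/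
def mittagLeffler (α γ z : ℝ) : ℝ :=
  ∑' k : ℕ, z ^ k / Real.Gamma (k * α + γ)

end

/-! Write `k_s` for the kernel `rlKernel s`, `I^s` for convolution with it, and `w` for the inner
fractional integral of `y`, of order `(1-β)(1-α)`. The Beta integral gives `k_s * k_t = k_(s+t)`,
hence the semigroup law for `I^s`.

The initial condition and absolute continuity give `w = ya + I^1 w'`. Applying `I^γ` and using `γ +
(1-β)(1-α) = 1` and `γ = α + β(1-α)` yields `I^1 y = ya k_(1+γ) + I^1 I^α (D y)`, where `D y` is the
Hilfer derivative. Differentiating almost everywhere gives the Volterra equation `y = ya k_γ + I^α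
(D y)` (`IsCauchySolution.ae_eq`).

By the Lipschitz condition the difference `U` of the two solutions satisfies `|U| ≤ |ε| k_γ + A I^α
|U|` almost everywhere. Since `I^α` sends `k_(kα+γ)` to `k_((k+1)α+γ)`, iteration
(`ae_le_sum_of_ae_le_rlInt`) produces partial sums of the Mittag-Leffler series and a remainder that
is a multiple of its `n`-th term. Continuity removes the exceptional null sets, and `n → ∞`
finishes. -/

/-! ### Riemann–Liouville kernels and the Beta integral. -/

/-- The convolution kernel `t₊^(s-1) / Γ(s)` of the Riemann–Liouville integral of order `s`. -/
noncomputable def rlKernel (s t : ℝ) : ℝ :=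
  if 0 < t then t ^ (s - 1) / Real.Gamma s else 0

lemma rlKernel_of_pos {s t : ℝ} (ht : 0 < t) : rlKernel s t = t ^ (s - 1) / Real.Gamma s :=
  if_pos ht

lemma rlKernel_of_nonpos {s t : ℝ} (ht : t ≤ 0) : rlKernel s t = 0 := if_neg ht.not_gt

lemma rlKernel_one_of_pos {t : ℝ} (ht : 0 < t) : rlKernel 1 t = 1 := by
  simp [rlKernel_of_pos ht]

lemma rlKernel_nonneg {s : ℝ} (hs : 0 < s) (t : ℝ) : 0 ≤ rlKernel s t := by
  unfold rlKernel
  have := Real.Gamma_pos_of_pos hs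
  split_ifs <;> positivity

@[fun_prop]
lemma measurable_rlKernel (s : ℝ) : Measurable (rlKernel s) :=
  Measurable.ite measurableSet_Ioi (by fun_prop) (by fun_prop)

/-- Rescaling the interval of length `d` to the unit interval turns the product into a multiple of a
beta density, whose total mass `1` evaluates the convolution of two kernels. Outside the unit
interval one of the two kernels vanishes. -/
lemma rlKernel_mul_scaled {s t d : ℝ} (hs : 0 < s) (ht : 0 < t) (hd : 0 < d) (u : ℝ) :
    rlKernel s (d - d * u) * rlKernel t (d * u) =
      d ^ (s + t - 2) / Real.Gamma (s + t) * ProbabilityTheory.betaPDFReal t s u := by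
  have h1 := Real.Gamma_pos_of_pos hs
  have h2 := Real.Gamma_pos_of_pos ht
  have h3 := Real.Gamma_pos_of_pos (add_pos hs ht)
  unfold ProbabilityTheory.betaPDFReal
  split_ifs with hu
  · have hu1 : 0 < 1 - u := by linarith [hu.2]
    have e : d - d * u = d * (1 - u) := by ring
    rw [e, rlKernel_of_pos (by positivity), rlKernel_of_pos (mul_pos hd hu.1),
      Real.mul_rpow hd.le hu1.le, Real.mul_rpow hd.le hu.1.le, ProbabilityTheory.beta,
      show s + t - 2 = (s - 1) + (t - 1) by ring, Real.rpow_add hd, add_comm t s]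
    field_simp
  · rw [mul_zero]
    by_cases h0 : 0 < u
    · have : 1 ≤ u := by by_contra! h; exact hu ⟨h0, h⟩
      rw [rlKernel_of_nonpos (by nlinarith), zero_mul]
    · rw [rlKernel_of_nonpos (t := d * u) (by nlinarith), mul_zero]

lemma betaPDFReal_nonneg {s t : ℝ} (hs : 0 < s) (ht : 0 < t) (u : ℝ) :
    0 ≤ ProbabilityTheory.betaPDFReal s t u := by
  by_cases hu : 0 < u ∧ u < 1
  · exact (ProbabilityTheory.betaPDFReal_pos hu.1 hu.2 hs ht).le
  · simp [ProbabilityTheory.betaPDFReal, hu]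

lemma integrable_betaPDFReal {s t : ℝ} (hs : 0 < s) (ht : 0 < t) :
    Integrable (ProbabilityTheory.betaPDFReal s t) := by
  refine ⟨by fun_prop, ?_⟩
  rw [hasFiniteIntegral_iff_ofReal (ae_of_all _ (betaPDFReal_nonneg hs ht))]
  exact (ProbabilityTheory.lintegral_betaPDF_eq_one hs ht).trans_lt ENNReal.one_lt_top

lemma integral_betaPDFReal {s t : ℝ} (hs : 0 < s) (ht : 0 < t) :
    ∫ u, ProbabilityTheory.betaPDFReal s t u = 1 := by
  rw [integral_eq_lintegral_of_nonneg_ae (ae_of_all _ (betaPDFReal_nonneg hs ht)) (by fun_prop)]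
  exact (congrArg ENNReal.toReal (ProbabilityTheory.lintegral_betaPDF_eq_one hs ht)).trans (by simp)

lemma integrable_rlKernel_mul_rlKernel {s t : ℝ} (hs : 0 < s) (ht : 0 < t) (x r : ℝ) :
    Integrable (fun τ => rlKernel s (x - τ) * rlKernel t (τ - r)) := by
  rcases le_or_gt x r with h | h
  · have : (fun τ => rlKernel s (x - τ) * rlKernel t (τ - r)) = fun _ => 0 := by
      funext τ
      rcases le_or_gt τ r with h' | h'
      · rw [rlKernel_of_nonpos (t := τ - r) (by linarith), mul_zero]
      · rw [rlKernel_of_nonpos (t := x - τ) (by linarith), zero_mul]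
    rw [this]
    exact integrable_zero _ _ _
  · have hd : 0 < x - r := sub_pos.2 h
    have h1 : Integrable
        (fun u => (fun v => rlKernel s (x - r - v) * rlKernel t v) ((x - r) * u)) := by
      simp only [rlKernel_mul_scaled hs ht hd]
      exact (integrable_betaPDFReal ht hs).const_mul _
    have h2 := ((integrable_comp_mul_left_iff
      (fun v => rlKernel s (x - r - v) * rlKernel t v) hd.ne').1 h1).comp_sub_right r
    simpa using h2

lemma integral_rlKernel_mul_rlKernel {s t : ℝ} (hs : 0 < s) (ht : 0 < t) (x r : ℝ) :
    ∫ τ, rlKernel s (x - τ) * rlKernel t (τ - r) = rlKernel (s + t) (x - r) := by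
  rcases le_or_gt x r with h | h
  · have : (fun τ => rlKernel s (x - τ) * rlKernel t (τ - r)) = fun _ => 0 := by
      funext τ
      rcases le_or_gt τ r with h' | h'
      · rw [rlKernel_of_nonpos (t := τ - r) (by linarith), mul_zero]
      · rw [rlKernel_of_nonpos (t := x - τ) (by linarith), zero_mul]
    rw [this, rlKernel_of_nonpos (by linarith), integral_zero]
  · have hd : 0 < x - r := sub_pos.2 h
    have h1 := Measure.integral_comp_mul_left
      (fun v => rlKernel s (x - r - v) * rlKernel t v) (x - r)
    simp only [rlKernel_mul_scaled hs ht hd] at h1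
    rw [integral_const_mul, integral_betaPDFReal ht hs, abs_of_pos (inv_pos.2 hd),
      ← integral_sub_right_eq_self (fun v => rlKernel s (x - r - v) * rlKernel t v) r] at h1
    simp only [sub_sub_sub_cancel_right, smul_eq_mul] at h1
    rw [eq_comm, inv_mul_eq_iff_eq_mul₀ hd.ne'] at h1
    rw [h1, rlKernel_of_pos hd, show s + t - 1 = (s + t - 2) + 1 by ring, Real.rpow_add hd,
      Real.rpow_one]
    ring

/-! ### The Riemann–Liouville integral on the line and its semigroup law. -/

/-- The Riemann–Liouville integral of order `s > 0` over the whole line, extended by the identity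
to `s = 0`. -/
noncomputable def rlInt (s : ℝ) (h : ℝ → ℝ) (x : ℝ) : ℝ :=
  if s = 0 then h x else ∫ τ, rlKernel s (x - τ) * h τ

lemma rlInt_zero (h : ℝ → ℝ) : rlInt 0 h = h := by
  funext x; simp [rlInt]

lemma rlInt_of_pos {s : ℝ} (hs : 0 < s) (h : ℝ → ℝ) (x : ℝ) :
    rlInt s h x = ∫ τ, rlKernel s (x - τ) * h τ := if_neg hs.ne'

lemma rlInt_rlKernel {s t : ℝ} (hs : 0 < s) (ht : 0 < t) (a x : ℝ) :
    rlInt s (fun τ => rlKernel t (τ - a)) x = rlKernel (s + t) (x - a) := by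
  rw [rlInt_of_pos hs, integral_rlKernel_mul_rlKernel hs ht]

lemma rlKernel_mul_congr {s : ℝ} {g h : ℝ → ℝ} {x : ℝ} (hgh : ∀ τ < x, g τ = h τ) (τ : ℝ) :
    rlKernel s (x - τ) * g τ = rlKernel s (x - τ) * h τ := by
  rcases lt_or_ge τ x with h' | h'
  · rw [hgh τ h']
  · rw [rlKernel_of_nonpos (by linarith), zero_mul, zero_mul]

lemma rlInt_congr {s : ℝ} {g h : ℝ → ℝ} {x : ℝ} (hgh : ∀ τ ≤ x, g τ = h τ) :
    rlInt s g x = rlInt s h x := by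
  unfold rlInt
  split_ifs
  · exact hgh x le_rfl
  · exact integral_congr_ae (ae_of_all _ (rlKernel_mul_congr fun τ hτ => hgh τ hτ.le))

lemma rlInt_eq_zero {s a : ℝ} {h : ℝ → ℝ} (hh : ∀ τ ≤ a, h τ = 0) {x : ℝ} (hx : x ≤ a) :
    rlInt s h x = 0 := by
  rw [rlInt_congr (h := fun _ => 0) fun τ hτ => hh τ (hτ.trans hx)]
  simp [rlInt]

/-- By Tonelli: integrating the absolute value over the middle variable first merges the two kernels
into one of order `s + t`, so integrability at the single point `x` suffices. -/
lemma integrable_rlKernel_prod {s t : ℝ} (hs : 0 < s) (ht : 0 < t) {h : ℝ → ℝ} {x : ℝ}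
    (hm : AEStronglyMeasurable h)
    (hi : Integrable (fun r => rlKernel (s + t) (x - r) * h r)) :
    Integrable (fun p : ℝ × ℝ => rlKernel s (x - p.1) * (rlKernel t (p.1 - p.2) * h p.2))
      (volume.prod volume) := by
  have hmeas : AEStronglyMeasurable
      (fun p : ℝ × ℝ => rlKernel s (x - p.1) * (rlKernel t (p.1 - p.2) * h p.2))
      (volume.prod volume) := by
    have h1 : Measurable fun p : ℝ × ℝ => rlKernel s (x - p.1) := by fun_prop
    have h2 : Measurable fun p : ℝ × ℝ => rlKernel t (p.1 - p.2) := by fun_prop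
    exact h1.aestronglyMeasurable.mul (h2.aestronglyMeasurable.mul hm.comp_snd)
  rw [integrable_prod_iff' hmeas]
  constructor
  · refine ae_of_all _ fun r => ?_
    have := (integrable_rlKernel_mul_rlKernel hs ht x r).mul_const (h r)
    simpa only [mul_assoc] using this
  · refine hi.norm.congr (ae_of_all _ fun r => ?_)
    have : ∀ τ, ‖rlKernel s (x - τ) * (rlKernel t (τ - r) * h r)‖ =
        rlKernel s (x - τ) * rlKernel t (τ - r) * ‖h r‖ := fun τ => by
      rw [norm_mul, norm_mul, Real.norm_of_nonneg (rlKernel_nonneg hs _),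
        Real.norm_of_nonneg (rlKernel_nonneg ht _), mul_assoc]
    simp only [this]
    rw [integral_mul_const, integral_rlKernel_mul_rlKernel hs ht, norm_mul,
      Real.norm_of_nonneg (rlKernel_nonneg (add_pos hs ht) _)]

lemma integrable_rlKernel_mul_rlInt {s t : ℝ} (hs : 0 < s) (ht : 0 ≤ t) {h : ℝ → ℝ} {x : ℝ}
    (hm : AEStronglyMeasurable h)
    (hi : Integrable (fun r => rlKernel (s + t) (x - r) * h r)) :
    Integrable (fun τ => rlKernel s (x - τ) * rlInt t h τ) := by
  rcases ht.eq_or_lt with rfl | ht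
  · simpa [rlInt_zero] using hi
  · have := (integrable_rlKernel_prod hs ht hm hi).integral_prod_left
    simpa only [integral_const_mul, ← rlInt_of_pos ht] using this

/-- The semigroup property of the Riemann–Liouville integral. -/
lemma rlInt_rlInt {s t : ℝ} (hs : 0 < s) (ht : 0 ≤ t) {h : ℝ → ℝ} {x : ℝ}
    (hm : AEStronglyMeasurable h)
    (hi : Integrable (fun r => rlKernel (s + t) (x - r) * h r)) :
    rlInt s (rlInt t h) x = rlInt (s + t) h x := by
  rcases ht.eq_or_lt with rfl | ht
  · simp [rlInt_zero]
  · have key := integral_integral_swap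
      (f := fun τ r => rlKernel s (x - τ) * (rlKernel t (τ - r) * h r))
      (integrable_rlKernel_prod hs ht hm hi)
    simp only [integral_const_mul, ← rlInt_of_pos ht] at key
    rw [rlInt_of_pos hs, key, rlInt_of_pos (add_pos hs ht)]
    refine integral_congr_ae (ae_of_all _ fun r => ?_)
    simp only [← mul_assoc]
    rw [integral_mul_const, integral_rlKernel_mul_rlKernel hs ht]

/-- For order at least `1` the kernel has no singularity, and it is bounded on the part of the
support of `h` to the left of `x`. -/
lemma integrable_rlKernel_mul_of_one_le {s a x : ℝ} (hs : 1 ≤ s) {h : ℝ → ℝ} (hi : Integrable h)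
    (hh : ∀ τ ≤ a, h τ = 0) : Integrable (fun r => rlKernel s (x - r) * h r) := by
  have hs0 : 0 < s := by linarith
  have hΓ := Real.Gamma_pos_of_pos hs0
  refine (hi.norm.const_mul (|x - a| ^ (s - 1) / Real.Gamma s)).mono' ?_ (ae_of_all _ fun r => ?_)
  · have : Measurable fun r => rlKernel s (x - r) := by fun_prop
    exact this.aestronglyMeasurable.mul hi.1
  · rcases le_or_gt r a with hr | hr
    · simp [hh r hr]
    rw [norm_mul, Real.norm_of_nonneg (rlKernel_nonneg hs0 _)]
    gcongr
    rcases le_or_gt x r with hx | hx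
    · rw [rlKernel_of_nonpos (by linarith)]; positivity
    · rw [rlKernel_of_pos (by linarith)]
      have h1 : x - r ≤ |x - a| := le_trans (by linarith) (le_abs_self _)
      gcongr

/-! ### Extension by zero and the weighted spaces. -/

lemma fracIntegral_eq_rlInt {a b s x : ℝ} (hs : 0 ≤ s) (hx : x ∈ Ioc a b) (y : ℝ → ℝ) :
    fracIntegral a s y x = rlInt s ((Ioc a b).indicator y) x := by
  unfold fracIntegral rlInt
  split_ifs with h0
  · rw [indicator_of_mem hx]
  · rw [intervalIntegral.integral_of_le hx.1.le, integral_Ioc_eq_integral_Ioo,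
      ← integral_indicator measurableSet_Ioo, ← integral_const_mul]
    congr 1
    funext τ
    by_cases hτ : τ ∈ Ioo a x
    · have hp : 0 < x - τ := sub_pos.2 hτ.2
      rw [indicator_of_mem hτ, indicator_of_mem (show τ ∈ Ioc a b from ⟨hτ.1, hτ.2.le.trans hx.2⟩),
        rlKernel_of_pos hp, show s - 1 = -(1 - s) by ring, Real.rpow_neg hp.le]
      field_simp
    · rw [indicator_of_notMem hτ, mul_zero]
      by_cases h1 : a < τ
      · rw [rlKernel_of_nonpos, zero_mul]
        by_contra! h2
        exact hτ ⟨h1, by linarith⟩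
      · rw [indicator_of_notMem (fun h => h1 h.1), mul_zero]

lemma MemWeightedC.exists_eq {a b γ : ℝ} {y : ℝ → ℝ} (hy : MemWeightedC a b (1 - γ) y) :
    ∃ g : ℝ → ℝ, ContinuousOn g (Icc a b) ∧ ∀ x ∈ Ioc a b, y x = g x * (x - a) ^ (γ - 1) := by
  obtain ⟨g, hg, h⟩ := hy
  refine ⟨g, hg, fun x hx => ?_⟩
  have hp : 0 < x - a := sub_pos.2 hx.1
  rw [h x hx, mul_comm (_ ^ _), mul_assoc, ← Real.rpow_add hp]
  simp

lemma MemWeightedC.continuousOn {a b γ : ℝ} {y : ℝ → ℝ} (hy : MemWeightedC a b (1 - γ) y) :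
    ContinuousOn y (Ioc a b) := by
  obtain ⟨g, hg, h⟩ := hy.exists_eq
  refine ContinuousOn.congr ?_ h
  refine (hg.mono Ioc_subset_Icc_self).mul (ContinuousOn.rpow_const (by fun_prop) ?_)
  exact fun x hx => Or.inl (sub_pos.2 hx.1).ne'

lemma MemWeightedC.exists_bound {a b γ : ℝ} (hγ : 0 < γ) {y : ℝ → ℝ}
    (hy : MemWeightedC a b (1 - γ) y) :
    ∃ M, 0 ≤ M ∧ ∀ x ∈ Ioc a b, |y x| ≤ M * rlKernel γ (x - a) := by
  obtain ⟨g, hg, h⟩ := hy.exists_eq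
  obtain ⟨C, hC⟩ := isCompact_Icc.exists_bound_of_continuousOn hg
  have hΓ := Real.Gamma_pos_of_pos hγ
  refine ⟨|C| * Real.Gamma γ, by positivity, fun x hx => ?_⟩
  have hp : 0 < x - a := sub_pos.2 hx.1
  rw [h x hx, rlKernel_of_pos hp, abs_mul, abs_of_pos (Real.rpow_pos_of_pos hp _), mul_assoc,
    mul_div_cancel₀ _ hΓ.ne']
  exact mul_le_mul_of_nonneg_right ((hC x (Ioc_subset_Icc_self hx)).trans (le_abs_self C))
    (Real.rpow_nonneg hp.le _)

lemma MemWeightedC.aestronglyMeasurable {a b γ : ℝ} {y : ℝ → ℝ}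
    (hy : MemWeightedC a b (1 - γ) y) : AEStronglyMeasurable ((Ioc a b).indicator y) :=
  (aestronglyMeasurable_indicator_iff measurableSet_Ioc).2
    (hy.continuousOn.aestronglyMeasurable measurableSet_Ioc)

lemma MemWeightedC.integrable_rlKernel_mul {a b γ s : ℝ} (hγ : 0 < γ) (hs : 0 < s) {y : ℝ → ℝ}
    (hy : MemWeightedC a b (1 - γ) y) (x : ℝ) :
    Integrable (fun τ => rlKernel s (x - τ) * (Ioc a b).indicator y τ) := by
  obtain ⟨M, hM, h⟩ := hy.exists_bound hγ
  have hm : Measurable fun τ => rlKernel s (x - τ) := by fun_prop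
  refine ((integrable_rlKernel_mul_rlKernel hs hγ x a).const_mul M).mono'
    (hm.aestronglyMeasurable.mul hy.aestronglyMeasurable) (ae_of_all _ fun τ => ?_)
  have h1 := rlKernel_nonneg hs (x - τ)
  have h2 := rlKernel_nonneg hγ (τ - a)
  rw [norm_mul, Real.norm_of_nonneg h1, mul_left_comm]
  gcongr
  by_cases hτ : τ ∈ Ioc a b
  · rw [indicator_of_mem hτ]; exact h τ hτ
  · rw [indicator_of_notMem hτ]; simp; positivity

lemma MemWeightedC.integrable {a b γ : ℝ} (hγ : 0 < γ) {y : ℝ → ℝ}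
    (hy : MemWeightedC a b (1 - γ) y) : Integrable ((Ioc a b).indicator y) := by
  -- Seen from `b + 1`, the kernel of order `1` equals `1` on all of `(a,b]`, including `b`.
  refine (hy.integrable_rlKernel_mul hγ one_pos (b + 1)).congr (ae_of_all _ fun τ => ?_)
  by_cases hτ : τ ∈ Ioc a b
  · simp only
    rw [rlKernel_one_of_pos (by linarith [hτ.2]), one_mul]
  · simp [indicator_of_notMem hτ]

/-! ### From the Cauchy problem to the Volterra equation. -/

/-- If the outer order is zero, `w'` is the Hilfer derivative itself and the weighted bound applies.
Otherwise the outer integral converges at `x = b`, and multiplying its integrand by the bounded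
factor `(b - t)^(1 - β(1-α))` recovers `w'`. -/
lemma HilferDifferentiable.integrableOn_innerDeriv {a b α β : ℝ} (hab : a < b) (hα0 : 0 < α)
    (hα1 : α < 1) (hβ0 : 0 ≤ β) (hβ1 : β ≤ 1) {y : ℝ → ℝ} (hy : HilferDifferentiable a b α β y)
    (hD : MemWeightedC a b (1 - (α + β * (1 - α))) (hilferDeriv a b α β y)) :
    IntegrableOn (innerDeriv a b α β y) (Ioc a b) := by
  have hτ0 : 0 ≤ β * (1 - α) := mul_nonneg hβ0 (by linarith)
  have hτ1 : β * (1 - α) ≤ 1 := by nlinarith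
  by_cases h : β * (1 - α) = 0
  · have := hD.integrable (by linarith)
    rw [integrable_indicator_iff measurableSet_Ioc] at this
    have e : hilferDeriv a b α β y = innerDeriv a b α β y := by
      funext x; simp [hilferDeriv, fracIntegral, h]
    rwa [e] at this
  · have h1 := hy.outer_of_ne_zero h b ⟨hab, le_rfl⟩
    have h2 : ContinuousOn (fun t => (b - t) ^ (1 - β * (1 - α))) (uIcc a b) :=
      ContinuousOn.rpow_const (by fun_prop) fun _ _ => Or.inr (by linarith)
    have h3 := h1.mul_continuousOn h2
    rw [intervalIntegrable_iff_integrableOn_Ioc_of_le hab.le,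
      integrableOn_Ioc_iff_integrableOn_Ioo] at h3
    rw [integrableOn_Ioc_iff_integrableOn_Ioo]
    refine h3.congr_fun (fun t ht => ?_) measurableSet_Ioo
    have : 0 < (b - t) ^ (1 - β * (1 - α)) := Real.rpow_pos_of_pos (sub_pos.2 ht.2) _
    simp only
    field_simp

/-- The fundamental theorem of calculus holds on each `[c,x]` with `a < c`; let `c` tend to `a`. The
value `w a` plays no role, only the limit does. -/
lemma eq_add_integral_derivWithin_of_tendsto {a b l : ℝ} {w : ℝ → ℝ}
    (hac : ∀ c ∈ Ioo a b, AbsolutelyContinuousOnInterval w c b)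
    (hint : IntegrableOn (derivWithin w (Ioc a b)) (Ioc a b))
    (hl : Tendsto w (𝓝[>] a) (𝓝 l)) {x : ℝ} (hx : x ∈ Ioc a b) :
    w x = l + ∫ t in a..x, derivWithin w (Ioc a b) t := by
  have hI : IntegrableOn (derivWithin w (Ioc a b)) (Ioc a x) :=
    hint.mono_set (Ioc_subset_Ioc_right hx.2)
  have h1 : ∀ c ∈ Ioo a x, w x - w c = ∫ t in c..x, derivWithin w (Ioc a b) t := by
    intro c hc
    have hcb : c ∈ Ioo a b := ⟨hc.1, hc.2.trans_le hx.2⟩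
    have hac' : AbsolutelyContinuousOnInterval w c x := (hac c hcb).mono (by
      rw [uIcc_of_le hc.2.le, uIcc_of_le hcb.2.le]
      exact Icc_subset_Icc_right hx.2)
    rw [← hac'.integral_deriv_eq_sub, intervalIntegral.integral_of_le hc.2.le,
      intervalIntegral.integral_of_le hc.2.le, integral_Ioc_eq_integral_Ioo,
      integral_Ioc_eq_integral_Ioo]
    refine setIntegral_congr_fun measurableSet_Ioo fun t ht => ?_
    exact (derivWithin_of_mem_nhds
      (Ioc_mem_nhds (hc.1.trans ht.1) (ht.2.trans_le hx.2))).symm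
  have h2 : Tendsto (fun c => ∫ t in c..x, derivWithin w (Ioc a b) t) (𝓝[>] a)
      (𝓝 (∫ t in a..x, derivWithin w (Ioc a b) t)) := by
    have hc := intervalIntegral.continuousOn_primitive_interval_left (μ := volume)
      (f := derivWithin w (Ioc a b)) (a := a) (b := x)
      (by rw [uIcc_of_le hx.1.le]; rwa [integrableOn_Icc_iff_integrableOn_Ioc])
    rw [uIcc_of_le hx.1.le] at hc
    have := hc a (left_mem_Icc.2 hx.1.le)
    exact this.mono_left (nhdsWithin_le_iff.2
      (mem_of_superset (Ioo_mem_nhdsGT hx.1) Ioo_subset_Icc_self))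
  have h3 : Tendsto (fun c => w x - w c) (𝓝[>] a) (𝓝 (w x - l)) := tendsto_const_nhds.sub hl
  have h4 := tendsto_nhds_unique_of_eventuallyEq h3 h2
    (by filter_upwards [Ioo_mem_nhdsGT hx.1] with c hc using h1 c hc)
  linarith

lemma ae_eq_zero_of_integral_eq_zero {a b : ℝ} (hab : a ≤ b) {g : ℝ → ℝ}
    (hg : IntegrableOn g (Ioc a b)) (h : ∀ x ∈ Ioc a b, ∫ t in a..x, g t = 0) :
    ∀ᵐ x, x ∈ Ioo a b → g x = 0 := by
  have hi : IntervalIntegrable g volume a b :=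
    (intervalIntegrable_iff_integrableOn_Ioc_of_le hab).2 hg
  filter_upwards [hi.ae_hasDerivAt_integral] with x hx hxab
  rw [uIcc_of_le hab] at hx
  have h1 := hx (Ioo_subset_Icc_self hxab) a (left_mem_Icc.2 hab)
  refine h1.unique ((hasDerivAt_const x (0 : ℝ)).congr_of_eventuallyEq ?_)
  filter_upwards [Ioo_mem_nhds hxab.1 hxab.2] with t ht using h t (Ioo_subset_Ioc_self ht)

lemma rlInt_one_eq_integral {a b : ℝ} {h : ℝ → ℝ} {x : ℝ} (hx : x ∈ Ioc a b) :
    rlInt 1 ((Ioc a b).indicator h) x = ∫ t in a..x, h t := by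
  rw [← fracIntegral_eq_rlInt zero_le_one hx]
  simp [fracIntegral]

lemma rlInt_add {s : ℝ} (hs : 0 < s) {g h : ℝ → ℝ} {x : ℝ}
    (hg : Integrable (fun τ => rlKernel s (x - τ) * g τ))
    (hh : Integrable (fun τ => rlKernel s (x - τ) * h τ)) :
    rlInt s (fun τ => g τ + h τ) x = rlInt s g x + rlInt s h x := by
  simp only [rlInt_of_pos hs, mul_add]
  exact integral_add hg hh

lemma rlInt_sub {s : ℝ} (hs : 0 < s) {g h : ℝ → ℝ} {x : ℝ}
    (hg : Integrable (fun τ => rlKernel s (x - τ) * g τ))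
    (hh : Integrable (fun τ => rlKernel s (x - τ) * h τ)) :
    rlInt s (fun τ => g τ - h τ) x = rlInt s g x - rlInt s h x := by
  simp only [rlInt_of_pos hs, mul_sub]
  exact integral_sub hg hh

lemma rlInt_const_mul {s : ℝ} (c : ℝ) (h : ℝ → ℝ) (x : ℝ) :
    rlInt s (fun τ => c * h τ) x = c * rlInt s h x := by
  unfold rlInt
  split_ifs
  · rfl
  · rw [← integral_const_mul]
    congr 1
    funext τ
    ring

/-- A solution of the Cauchy-type problem satisfies the equivalent Volterra equation almost
everywhere. -/
lemma IsCauchySolution.ae_eq {a b α β ya : ℝ} {f : ℝ → ℝ → ℝ} {y : ℝ → ℝ} (hab : a < b)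
    (hα0 : 0 < α) (hα1 : α < 1) (hβ0 : 0 ≤ β) (hβ1 : β ≤ 1)
    (hy : IsCauchySolution a b α β f ya y) :
    ∀ᵐ x, x ∈ Ioo a b → y x = ya * rlKernel (α + β * (1 - α)) (x - a) +
      rlInt α ((Ioc a b).indicator (hilferDeriv a b α β y)) x := by
  obtain ⟨⟨hyC, hdiff, hDC⟩, -, hinit⟩ := hy
  have hτ0 : 0 ≤ β * (1 - α) := mul_nonneg hβ0 (by linarith)
  have hσ0 : 0 ≤ (1 - β) * (1 - α) := mul_nonneg (by linarith) (by linarith)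
  have hσ : 1 - (α + β * (1 - α)) = (1 - β) * (1 - α) := by ring
  have hγ0 : 0 < α + β * (1 - α) := by linarith
  have hsum : α + β * (1 - α) + (1 - β) * (1 - α) = 1 := by ring
  have hVi := hdiff.integrableOn_innerDeriv hab hα0 hα1 hβ0 hβ1 hDC
  have hYi := hyC.integrable hγ0
  have hDi := hDC.integrable hγ0
  rw [hσ] at hinit
  generalize hY : (Ioc a b).indicator y = Y at *
  generalize hD : (Ioc a b).indicator (hilferDeriv a b α β y) = D at *
  set V := (Ioc a b).indicator (innerDeriv a b α β y) with hV
  have hVint : Integrable V := (integrable_indicator_iff measurableSet_Ioc).2 hVi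
  have zero_of_le : ∀ h : ℝ → ℝ, ∀ τ ≤ a, (Ioc a b).indicator h τ = 0 := fun h τ hτ =>
    indicator_of_notMem (fun hm => hm.1.not_ge hτ) _
  have hY0 : ∀ τ ≤ a, Y τ = 0 := hY ▸ zero_of_le y
  have hD0 : ∀ τ ≤ a, D τ = 0 := hD ▸ zero_of_le _
  have hV0 : ∀ τ ≤ a, V τ = 0 := zero_of_le _
  -- the inner fractional integral is the primitive of its derivative
  have hw : ∀ τ ≤ b, rlInt ((1 - β) * (1 - α)) Y τ =
      ya * rlKernel 1 (τ - a) + rlInt 1 V τ := by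
    intro τ hτb
    rcases le_or_gt τ a with hτ | hτ
    · rw [rlInt_eq_zero hY0 hτ, rlInt_eq_zero hV0 hτ, rlKernel_of_nonpos (by linarith)]
      ring
    · have hm : τ ∈ Ioc a b := ⟨hτ, hτb⟩
      rw [rlKernel_one_of_pos (sub_pos.2 hτ), mul_one, hV, rlInt_one_eq_integral hm, ← hY,
        ← fracIntegral_eq_rlInt hσ0 hm]
      exact eq_add_integral_derivWithin_of_tendsto hdiff.absCont hVi hinit hm
  -- Restricted to `τ ≤ b`: beyond `b` the left side is cut off but the right side need not vanish.
  -- `rlInt_congr` only needs agreement to the left of the evaluation point.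
  have hDV : ∀ τ ≤ b, D τ = rlInt (β * (1 - α)) V τ := by
    intro τ hτb
    rcases le_or_gt τ a with hτ | hτ
    · rw [rlInt_eq_zero hV0 hτ, hD0 τ hτ]
    · have hm : τ ∈ Ioc a b := ⟨hτ, hτb⟩
      rw [← hD, indicator_of_mem hm, hilferDeriv, fracIntegral_eq_rlInt hτ0 hm]
  have hDα : ∀ x, Integrable (fun τ => rlKernel 1 (x - τ) * rlInt α D τ) := fun x =>
    integrable_rlKernel_mul_rlInt one_pos hα0.le hDi.1
      (integrable_rlKernel_mul_of_one_le (by linarith) hDi hD0)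
  have hK : ∀ x, Integrable
      (fun τ => rlKernel 1 (x - τ) * (ya * rlKernel (α + β * (1 - α)) (τ - a))) := fun x => by
    simpa only [mul_left_comm] using
      (integrable_rlKernel_mul_rlKernel one_pos hγ0 x a).const_mul ya
  have hsumI : ∀ x, Integrable (fun τ => rlKernel 1 (x - τ) *
      (ya * rlKernel (α + β * (1 - α)) (τ - a) + rlInt α D τ)) := fun x =>
    ((hK x).add (hDα x)).congr (ae_of_all _ fun τ => (mul_add _ _ _).symm)
  have hY1 : ∀ x, Integrable (fun τ => rlKernel 1 (x - τ) * Y τ) := fun x =>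
    integrable_rlKernel_mul_of_one_le le_rfl hYi hY0
  -- Both sides reduce to `ya k_(1+γ) + I^(1+γ) V`. Every semigroup step ends at a total order of at
  -- least `1`, where integrability is automatic.
  have key : ∀ x ≤ b, rlInt 1 Y x = ya * rlKernel (1 + (α + β * (1 - α))) (x - a) +
      rlInt 1 (rlInt α D) x := by
    intro x hx
    have e1 : rlInt 1 Y x =
        rlInt (α + β * (1 - α)) (rlInt ((1 - β) * (1 - α)) Y) x := by
      rw [rlInt_rlInt hγ0 hσ0 hYi.1 (by rw [hsum]; exact hY1 x), hsum]
    have hV1 : Integrable (fun r => rlKernel (α + β * (1 - α) + 1) (x - r) * V r) :=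
      integrable_rlKernel_mul_of_one_le (by linarith) hVint hV0
    rw [e1, rlInt_congr fun τ hτ => hw τ (hτ.trans hx), rlInt_add hγ0, rlInt_const_mul,
      rlInt_rlKernel hγ0 one_pos, rlInt_rlInt hγ0 zero_le_one hVint.1 hV1,
      rlInt_rlInt one_pos hα0.le hDi.1
        (integrable_rlKernel_mul_of_one_le (by linarith) hDi hD0),
      rlInt_congr fun τ hτ => hDV τ (hτ.trans hx), rlInt_rlInt (by linarith) hτ0 hVint.1]
    · rw [show α + β * (1 - α) + 1 = 1 + α + β * (1 - α) by ring,
        show 1 + (α + β * (1 - α)) = 1 + α + β * (1 - α) by ring]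
    · exact integrable_rlKernel_mul_of_one_le (by linarith) hVint hV0
    · simpa only [mul_left_comm] using
        (integrable_rlKernel_mul_rlKernel hγ0 one_pos x a).const_mul ya
    · exact integrable_rlKernel_mul_rlInt hγ0 zero_le_one hVint.1 hV1
  set g : ℝ → ℝ := fun τ => Y τ - (ya * rlKernel (α + β * (1 - α)) (τ - a) + rlInt α D τ)
    with hg
  have hg1 : ∀ x ≤ b, rlInt 1 g x = 0 := by
    intro x hx
    rw [hg, rlInt_sub one_pos (hY1 x), rlInt_add one_pos (hK x) (hDα x), rlInt_const_mul,
      rlInt_rlKernel one_pos hγ0, key x hx, sub_self]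
    exact hsumI x
  have hg0 : ∀ τ ≤ a, g τ = 0 := fun τ hτ => by
    simp only [hg]
    rw [hY0 τ hτ, rlInt_eq_zero hD0 hτ, rlKernel_of_nonpos (by linarith)]
    ring
  have hgi : IntegrableOn g (Ioc a b) := by
    have h1 : Integrable (fun τ => rlKernel 1 (b + 1 - τ) * g τ) := by
      simp only [hg, mul_sub _ (Y _)]
      exact (hY1 _).sub (hsumI _)
    refine h1.integrableOn.congr_fun (fun τ hτ => ?_) measurableSet_Ioc
    simp only
    rw [rlKernel_one_of_pos (by linarith [hτ.2]), one_mul]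
  have hae := ae_eq_zero_of_integral_eq_zero hab.le hgi fun x hx => by
    rw [← rlInt_one_eq_integral hx, ← hg1 x hx.2]
    refine rlInt_congr fun τ hτ => ?_
    rcases le_or_gt τ a with h | h
    · rw [zero_of_le g τ h, hg0 τ h]
    · exact indicator_of_mem (show τ ∈ Ioc a b from ⟨h, hτ.trans hx.2⟩) _
  filter_upwards [hae] with x hx hxab
  have h1 := hx hxab
  simp only [hg] at h1
  rw [← hY, indicator_of_mem (Ioo_subset_Ioc_self hxab)] at h1
  linarith

/-! ### Growth of Gamma and convergence of the Mittag-Leffler series. -/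

/-- Keep only the part of the Gamma integral beyond `R`, where `x^(s-1) ≥ R^(s-1)`. As `R` is free,
Gamma outgrows every geometric sequence. -/
lemma rpow_mul_exp_neg_le_Gamma {R s : ℝ} (hR : 0 < R) (hs : 1 ≤ s) :
    R ^ (s - 1) * Real.exp (-R) ≤ Real.Gamma s := by
  have hs0 : 0 < s := by linarith
  have hi := Real.GammaIntegral_convergent hs0
  rw [Real.Gamma_eq_integral hs0, ← integral_exp_neg_Ioi R, ← integral_const_mul]
  calc ∫ x in Ioi R, R ^ (s - 1) * Real.exp (-x)
      ≤ ∫ x in Ioi R, Real.exp (-x) * x ^ (s - 1) := by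
        refine setIntegral_mono_on ((integrableOn_exp_neg_Ioi R).const_mul _)
          (hi.mono_set (Ioi_subset_Ioi hR.le)) measurableSet_Ioi fun x hx => ?_
        rw [mul_comm]
        have hx' : R ≤ x := le_of_lt hx
        gcongr
    _ ≤ ∫ x in Ioi 0, Real.exp (-x) * x ^ (s - 1) := by
        refine setIntegral_mono_set hi ?_ (Ioi_subset_Ioi hR.le).eventuallyLE
        filter_upwards [ae_restrict_mem measurableSet_Ioi] with x hx
        have : 0 < x := hx
        simp only [Pi.zero_apply]
        positivity

lemma summable_mittagLeffler {α : ℝ} (hα : 0 < α) (γ z : ℝ) :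
    Summable fun k : ℕ => z ^ k / Real.Gamma (k * α + γ) := by
  -- Chosen so that `R^α = 2|z| + 1`, which makes the comparison ratio `|z| / R^α` less than `1`.
  set R : ℝ := (2 * |z| + 1) ^ α⁻¹ with hRdef
  have hR : 0 < R := by positivity
  have hRα : R ^ α = 2 * |z| + 1 := by
    rw [hRdef, ← Real.rpow_mul (by positivity), inv_mul_cancel₀ hα.ne', Real.rpow_one]
  have hq : |z| / R ^ α < 1 := by
    rw [hRα, div_lt_one (by positivity)]
    linarith [abs_nonneg z]
  have hgeo := (summable_geometric_of_lt_one (by positivity) hq).mul_left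
    (Real.exp R * R ^ (1 - γ))
  refine Summable.of_norm_bounded_eventually_nat hgeo ?_
  have hlarge : ∀ᶠ k : ℕ in atTop, 1 ≤ k * α + γ :=
    (tendsto_atTop_add_const_right _ γ
      (tendsto_natCast_atTop_atTop.atTop_mul_const hα)).eventually_ge_atTop 1
  filter_upwards [hlarge] with k hk
  have h1 := rpow_mul_exp_neg_le_Gamma hR hk
  have h2 : R ^ (k * α + γ - 1) = (R ^ α) ^ k / R ^ (1 - γ) := by
    rw [← Real.rpow_natCast, ← Real.rpow_mul hR.le, ← Real.rpow_sub hR]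
    ring_nf
  have hΓ := Real.Gamma_pos_of_pos (show 0 < k * α + γ by linarith)
  rw [norm_div, norm_pow, Real.norm_of_nonneg hΓ.le, Real.norm_eq_abs]
  calc |z| ^ k / Real.Gamma (k * α + γ)
      ≤ |z| ^ k / (R ^ (k * α + γ - 1) * Real.exp (-R)) := by gcongr
    _ = Real.exp R * R ^ (1 - γ) * (|z| / R ^ α) ^ k := by
        rw [h2, Real.exp_neg, div_pow]
        field_simp

lemma pow_mul_rlKernel_eq {α : ℝ} (γ A : ℝ) {d : ℝ} (hd : 0 < d) (k : ℕ) :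
    A ^ k * rlKernel (k * α + γ) d =
      d ^ (γ - 1) * ((A * d ^ α) ^ k / Real.Gamma (k * α + γ)) := by
  rw [rlKernel_of_pos hd, add_sub_assoc, Real.rpow_add hd, mul_comm (k : ℝ), Real.rpow_mul hd.le,
    Real.rpow_natCast, mul_pow]
  ring

/-! ### Iteration of the fractional Gronwall inequality. -/

lemma integrable_rlKernel_mul_sum {α γ : ℝ} (hα : 0 < α) (hγ : 0 < γ) (a x : ℝ) (c : ℕ → ℝ)
    (n : ℕ) : Integrable (fun τ => rlKernel α (x - τ) *
      ∑ k ∈ Finset.range n, c k * rlKernel (k * α + γ) (τ - a)) := by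
  simp only [Finset.mul_sum, mul_left_comm _ (c _)]
  exact integrable_finsetSum _ fun k _ =>
    (integrable_rlKernel_mul_rlKernel hα (by positivity) x a).const_mul _

lemma rlInt_sum_rlKernel {α γ : ℝ} (hα : 0 < α) (hγ : 0 < γ) (a x : ℝ) (c : ℕ → ℝ) (n : ℕ) :
    rlInt α (fun τ => ∑ k ∈ Finset.range n, c k * rlKernel (k * α + γ) (τ - a)) x =
      ∑ k ∈ Finset.range n, c k * rlKernel ((k + 1 : ℕ) * α + γ) (x - a) := by
  rw [rlInt_of_pos hα]
  simp only [Finset.mul_sum, mul_left_comm _ (c _)]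
  rw [integral_finsetSum _ fun k _ =>
    (integrable_rlKernel_mul_rlKernel hα (by positivity) x a).const_mul _]
  refine Finset.sum_congr rfl fun k _ => ?_
  rw [integral_const_mul, integral_rlKernel_mul_rlKernel hα (by positivity)]
  congr 2
  push_cast
  ring

/-- Iterated form of the fractional Gronwall inequality. -/
lemma ae_le_sum_of_ae_le_rlInt {a α γ A e M : ℝ} (hα : 0 < α) (hγ : 0 < γ) (hA : 0 ≤ A)
    {U : ℝ → ℝ} (hU : ∀ x, |U x| ≤ M * rlKernel γ (x - a))
    (hUe : ∀ᵐ x, |U x| ≤ e * rlKernel γ (x - a) + A * rlInt α (fun τ => |U τ|) x) (n : ℕ) :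
    ∀ᵐ x, |U x| ≤ ∑ k ∈ Finset.range n, e * A ^ k * rlKernel (k * α + γ) (x - a) +
      M * A ^ n * rlKernel (n * α + γ) (x - a) := by
  induction n with
  | zero => exact ae_of_all _ fun x => by simpa using hU x
  | succ n ih =>
    filter_upwards [hUe] with x hx
    refine hx.trans ?_
    have hi1 := integrable_rlKernel_mul_sum hα hγ a x (fun k => e * A ^ k) n
    have hi2 : Integrable (fun τ => rlKernel α (x - τ) *
        (M * A ^ n * rlKernel (n * α + γ) (τ - a))) := by
      simpa only [mul_left_comm] using
        (integrable_rlKernel_mul_rlKernel hα (by positivity : 0 < n * α + γ) x a).const_mul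
          (M * A ^ n)
    have h1 : rlInt α (fun τ => |U τ|) x ≤
        rlInt α (fun τ => ∑ k ∈ Finset.range n, e * A ^ k * rlKernel (k * α + γ) (τ - a) +
          M * A ^ n * rlKernel (n * α + γ) (τ - a)) x := by
      rw [rlInt_of_pos hα, rlInt_of_pos hα]
      refine integral_mono_of_nonneg
        (ae_of_all _ fun τ => mul_nonneg (rlKernel_nonneg hα _) (abs_nonneg _))
        ((hi1.add hi2).congr (ae_of_all _ fun τ => (mul_add _ _ _).symm)) ?_
      -- The induction hypothesis is used only under the integral, so its exceptional null set is
      -- harmless.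
      filter_upwards [ih] with τ hτ
      exact mul_le_mul_of_nonneg_left hτ (rlKernel_nonneg hα _)
    rw [rlInt_add hα hi1 hi2, rlInt_const_mul, rlInt_rlKernel hα (by positivity),
      rlInt_sum_rlKernel hα hγ a x (fun k => e * A ^ k) n] at h1
    refine (add_le_add_right (mul_le_mul_of_nonneg_left h1 hA) _).trans_eq ?_
    -- The `k = 0` term is the inhomogeneity `e k_γ`; the other terms are the old sum shifted by
    -- one.
    rw [Finset.sum_range_succ', mul_add, Finset.mul_sum,
      show α + (n * α + γ) = (n + 1 : ℕ) * α + γ by push_cast; ring, ← add_assoc]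
    congr 1
    · rw [add_comm]
      congr 1
      · exact Finset.sum_congr rfl fun k _ => by ring
      · simp
    · ring

/-! ### From almost everywhere to everywhere, and the estimate. -/

lemma continuousOn_rlKernel_sub (s a : ℝ) : ContinuousOn (fun x => rlKernel s (x - a)) (Ioi a) := by
  have : ContinuousOn (fun x => (x - a) ^ (s - 1) / Real.Gamma s) (Ioi a) :=
    (ContinuousOn.rpow_const (by fun_prop) fun x hx => Or.inl (sub_pos.2 hx).ne').div_const _
  exact this.congr fun x hx => rlKernel_of_pos (sub_pos.2 hx)

/-- The inequality says `max f g = g`, and continuous functions equal almost everywhere on a set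
lying in the closure of its interior are equal on it, here including the endpoint `b`. -/
lemma le_on_Ioc_of_ae_le {a b : ℝ} {f g : ℝ → ℝ} (hf : ContinuousOn f (Ioc a b))
    (hg : ContinuousOn g (Ioc a b)) (h : ∀ᵐ x, x ∈ Ioc a b → f x ≤ g x) :
    ∀ x ∈ Ioc a b, f x ≤ g x := by
  have h1 : EqOn (fun x => max (f x) (g x)) g (Ioc a b) := by
    refine Measure.eqOn_of_ae_eq (μ := volume) ?_ (hf.sup hg) hg ?_
    · rw [EventuallyEq, ae_restrict_iff' measurableSet_Ioc]
      filter_upwards [h] with x hx hxm using max_eq_right (hx hxm)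
    · rcases lt_or_ge a b with hab | hab
      · rw [interior_Ioc, closure_Ioo hab.ne]
        exact Ioc_subset_Icc_self
      · simp [Ioc_eq_empty hab.not_gt]
  exact fun x hx => max_eq_right_iff.1 (h1 hx)

theorem theorem4p2 (a b α β γ A : ℝ) (hab : a < b)
    (hα0 : 0 < α) (hα1 : α < 1) (hβ0 : 0 ≤ β) (hβ1 : β ≤ 1) (hγ : γ = α + β - α * β)
    (f : ℝ → ℝ → ℝ)
    (hf : ∀ y : ℝ → ℝ, MemWeightedC a b (1 - γ) y →
      MemWeightedC a b (1 - γ) (fun x => f x (y x)))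
    (hA : 0 < A)
    (hLip : ∀ x ∈ Ioc a b, ∀ y₁ y₂ : ℝ, |f x y₁ - f x y₂| ≤ A * |y₁ - y₂|)
    (ya ε : ℝ) (y yhat : ℝ → ℝ)
    (hy : IsCauchySolution a b α β f ya y)
    (hyhat : IsCauchySolution a b α β f (ya + ε) yhat) :
    ∀ x ∈ Ioc a b,
      |y x - yhat x| ≤
        |ε| * (x - a) ^ (γ - 1) * mittagLeffler α γ (A * (x - a) ^ α) := by
  have hγ' : α + β * (1 - α) = γ := by rw [hγ]; ring
  have hγ0 : 0 < γ := by
    rw [← hγ']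
    linarith [mul_nonneg hβ0 (sub_nonneg.2 hα1.le)]
  have e1 := hy.ae_eq hab hα0 hα1 hβ0 hβ1
  have e2 := hyhat.ae_eq hab hα0 hα1 hβ0 hβ1
  obtain ⟨⟨hyC, -, hDC⟩, hyf, -⟩ := hy
  obtain ⟨⟨hzC, -, hEC⟩, hzf, -⟩ := hyhat
  rw [hγ'] at e1 e2 hyC hDC hzC hEC
  have hD := hDC.integrable_rlKernel_mul hγ0 hα0
  have hE := hEC.integrable_rlKernel_mul hγ0 hα0
  have hY := hyC.integrable_rlKernel_mul hγ0 hα0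
  have hZ := hzC.integrable_rlKernel_mul hγ0 hα0
  obtain ⟨M₁, hM₁, hb₁⟩ := hyC.exists_bound hγ0
  obtain ⟨M₂, hM₂, hb₂⟩ := hzC.exists_bound hγ0
  set D := (Ioc a b).indicator (hilferDeriv a b α β y) with hDdef
  set E := (Ioc a b).indicator (hilferDeriv a b α β yhat) with hEdef
  set U : ℝ → ℝ := fun x => (Ioc a b).indicator y x - (Ioc a b).indicator yhat x with hUdef
  have hU_of_mem : ∀ x ∈ Ioc a b, U x = y x - yhat x := fun x hx => by
    simp [hUdef, indicator_of_mem hx]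
  have hU_of_notMem : ∀ x ∉ Ioc a b, U x = 0 := fun x hx => by
    simp [hUdef, indicator_of_notMem hx]
  have hU : ∀ x, |U x| ≤ (M₁ + M₂) * rlKernel γ (x - a) := by
    intro x
    by_cases hx : x ∈ Ioc a b
    · rw [hU_of_mem x hx, add_mul]
      exact (abs_sub _ _).trans (add_le_add (hb₁ x hx) (hb₂ x hx))
    · rw [hU_of_notMem x hx, abs_zero]
      exact mul_nonneg (add_nonneg hM₁ hM₂) (rlKernel_nonneg hγ0 _)
  have hDE : ∀ x, |D x - E x| ≤ A * |U x| := by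
    intro x
    by_cases hx : x ∈ Ioc a b
    · rw [hU_of_mem x hx, hDdef, hEdef, indicator_of_mem hx, indicator_of_mem hx, hyf x hx,
        hzf x hx]
      exact hLip x hx _ _
    · simp [hU_of_notMem x hx, hDdef, hEdef, indicator_of_notMem hx]
  have hUint : ∀ x, Integrable (fun τ => rlKernel α (x - τ) * (A * |U τ|)) := fun x => by
    have h1 : Integrable (fun τ => rlKernel α (x - τ) * U τ) :=
      ((hY x).sub (hZ x)).congr (ae_of_all _ fun τ => (mul_sub _ _ _).symm)
    refine (h1.norm.const_mul A).congr (ae_of_all _ fun τ => ?_)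
    simp only [norm_mul, Real.norm_of_nonneg (rlKernel_nonneg hα0 _), Real.norm_eq_abs]
    ring
  have hUe : ∀ᵐ x, |U x| ≤ |ε| * rlKernel γ (x - a) + A * rlInt α (fun τ => |U τ|) x := by
    -- The Volterra equation is available only on the open interval; the endpoint is a null set.
    have hb : ∀ᵐ x : ℝ, x ≠ b := by simp [ae_iff]
    filter_upwards [e1, e2, hb] with x h1 h2 hxb
    have hκ := rlKernel_nonneg hγ0 (x - a)
    by_cases hx : x ∈ Ioc a b
    · have hx' : x ∈ Ioo a b := ⟨hx.1, lt_of_le_of_ne hx.2 hxb⟩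
      have h3 : U x = -(ε * rlKernel γ (x - a)) + rlInt α (fun τ => D τ - E τ) x := by
        rw [hU_of_mem x hx, h1 hx', h2 hx', rlInt_sub hα0 (hD x) (hE x)]
        ring
      have h4 : |rlInt α (fun τ => D τ - E τ) x| ≤ A * rlInt α (fun τ => |U τ|) x := by
        rw [← rlInt_const_mul, rlInt_of_pos hα0, rlInt_of_pos hα0, ← Real.norm_eq_abs]
        refine norm_integral_le_of_norm_le (hUint x) (ae_of_all _ fun τ => ?_)
        rw [norm_mul, Real.norm_of_nonneg (rlKernel_nonneg hα0 _)]
        exact mul_le_mul_of_nonneg_left (hDE τ) (rlKernel_nonneg hα0 _)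
      rw [h3]
      refine (abs_add_le _ _).trans (add_le_add ?_ h4)
      rw [abs_neg, abs_mul, abs_of_nonneg hκ]
    · rw [hU_of_notMem x hx, abs_zero, rlInt_of_pos hα0]
      have : 0 ≤ ∫ τ, rlKernel α (x - τ) * |U τ| :=
        integral_nonneg fun τ => mul_nonneg (rlKernel_nonneg hα0 _) (abs_nonneg _)
      positivity
  intro x hx
  have hd : 0 < x - a := sub_pos.2 hx.1
  have hsum := summable_mittagLeffler hα0 γ (A * (x - a) ^ α)
  have hbound : ∀ n : ℕ, |y x - yhat x| ≤
      |ε| * (x - a) ^ (γ - 1) * mittagLeffler α γ (A * (x - a) ^ α) +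
        (M₁ + M₂) * (x - a) ^ (γ - 1) *
          ((A * (x - a) ^ α) ^ n / Real.Gamma (n * α + γ)) := by
    intro n
    have hcont : ContinuousOn (fun x => ∑ k ∈ Finset.range n,
        |ε| * A ^ k * rlKernel (k * α + γ) (x - a) +
          (M₁ + M₂) * A ^ n * rlKernel (n * α + γ) (x - a)) (Ioc a b) := by
      have hk : ∀ s, ContinuousOn (fun x => rlKernel s (x - a)) (Ioc a b) := fun s =>
        (continuousOn_rlKernel_sub s a).mono fun _ h => h.1
      exact (continuousOn_finsetSum _ fun k _ => (hk _).const_mul _).add ((hk _).const_mul _)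
    have h1 := le_on_Ioc_of_ae_le (hyC.continuousOn.sub hzC.continuousOn).abs hcont (by
      filter_upwards [ae_le_sum_of_ae_le_rlInt hα0 hγ0 hA.le hU hUe n] with t ht htm
      rw [hU_of_mem t htm] at ht
      exact ht) x hx
    refine h1.trans (add_le_add ?_ (le_of_eq ?_))
    · simp only [mul_assoc |ε|, pow_mul_rlKernel_eq γ A hd]
      rw [← Finset.mul_sum, ← Finset.mul_sum]
      gcongr
      refine hsum.sum_le_tsum _ fun k _ => ?_
      have := Real.Gamma_pos_of_pos (show 0 < k * α + γ by positivity)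
      positivity
    · rw [mul_assoc, pow_mul_rlKernel_eq γ A hd, ← mul_assoc]
  -- The remainder is a constant times the general term of a convergent series, so it tends to zero.
  have hlim := (hsum.tendsto_atTop_zero.const_mul
    ((M₁ + M₂) * (x - a) ^ (γ - 1))).const_add
      (|ε| * (x - a) ^ (γ - 1) * mittagLeffler α γ (A * (x - a) ^ α))
  rw [mul_zero, add_zero] at hlim
  exact ge_of_tendsto' hlim hbound
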